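/- Let $H_1,H_2,H_+,H_-$ be complex Hilbert spaces, let $\Omega\subset\mathbb C$ be a connected open set, and let $P(z):H_1\to H_2$, $z\in\Omega$, be a family of bounded Fredholm operators (finite-dimensional kernel and cokernel) depending holomorphically on $z$. Let $R_-(z):H_-\to H_2$ and $R_+(z):H_1\to H_+$ be bounded operators of finite rank depending holomorphically on $z\in\Omega$, and suppose that for every $z\in\Omega$ the Grushin problem is well posed, that is, the operator $$\mathcal P(z)=\begin{pmatrix}P(z)&R_-(z)\\R_+(z)&0\end{pmatrix}:H_1\oplus H_-\to H_2\oplus H_+$$ has a bounded two-sided inverse $$\mathcal E(z)=\begin{pmatrix}E(z)&E_+(z)\\E_-(z)&E_{-+}(z)\end{pmatrix}:H_2\oplus H_+\to H_1\oplus H_-.$$ Suppose that $E_{-+}(z_0):H_+\to H_-$ is invertible at some $z_0\in\Omega$, and let $g:\Omega\to\mathbb C$ be holomorphic. Let $\gamma$ be a closed piecewise $C^1$ curve in $\Omega$ that is homologous to $0$ in $\Omega$ (its winding number around every point of $\mathbb C\setminus\Omega$ is $0$) and such that $P(z)$ is invertible for every $z$ on $\gamma$. Write $\dot A=\partial_z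 A$. Then $E_{-+}$ is holomorphic in $\Omega$ and $E_{-+}(z)$ is invertible for every $z$ on $\gamma$, both integrals below converge and are operators of trace class (on $H_2$ and on $H_-$ respectively), and $$\operatorname{tr}\int_\gamma \dot P(z)P(z)^{-1}g(z)\,dz=\operatorname{tr}\int_\gamma \dot E_{-+}(z)E_{-+}(z)^{-1}g(z)\,dz .$$ Here a bounded operator $A:H\to K$ of Hilbert spaces is of trace class if $(AA^*)^{1/2}$ has an orthonormal basis of eigenvectors with summable eigenvalues, counted with multiplicity, and $\operatorname{tr}A=\sum_j\langle Ae_j,e_j\rangle$ for any orthonormal basis $(e_j)$ when $H=K$. -/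

import Mathlib

open scoped InnerProductSpace

noncomputable section

namespace Grushin

section Operators

variable {H K : Type*} [NormedAddCommGroup H] [NormedAddCommGroup K]

/-- A bounded operator is Fredholm when its kernel and its cokernel are finite dimensional. -/
def IsFredholm [NormedSpace ℂ H] [NormedSpace ℂ K] (A : H →L[ℂ] K) : Prop :=
  FiniteDimensional ℂ A.ker ∧ FiniteDimensional ℂ (K ⧸ A.range)

/-- A bounded operator has finite rank when its range is finite dimensional. -/
def HasFiniteRank [NormedSpace ℂ H] [NormedSpace ℂ K] (A : H →L[ℂ] K) : Prop :=
  FiniteDimensional ℂ A.range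

/-- `A : H → K` is of trace class: the positive operator `(A A*)^{1/2}` on `K` has an orthonormal
basis of eigenvectors, with a summable family of eigenvalues (counted with multiplicity). The
basis is indexed by the set of its vectors, see `exists_hilbertBasis`. -/
def IsTraceClass [InnerProductSpace ℂ H] [CompleteSpace H] [InnerProductSpace ℂ K]
    [CompleteSpace K] (A : H →L[ℂ] K) : Prop :=
  ∃ (s : Set K) (b : HilbertBasis s ℂ K) (μ : s → ℝ),
    (∀ i, CFC.sqrt (A ∘L ContinuousLinearMap.adjoint A) (b i) = (μ i : ℂ) • b i) ∧ Summable μ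

/-- `τ` is the trace of `A`: for every orthonormal basis `(e_i)` of `H` the series
`∑ ⟨A e_i, e_i⟩` converges to `τ`. In Mathlib the inner product is linear in the second
argument. -/
def HasTrace [InnerProductSpace ℂ H] (A : H →L[ℂ] H) (τ : ℂ) : Prop :=
  ∀ (s : Set H) (e : HilbertBasis s ℂ H), HasSum (fun i => ⟪e i, A (e i)⟫_ℂ) τ

end Operators

section Problem

variable {H₁ H₂ Hp Hm : Type*}
  [NormedAddCommGroup H₁] [NormedSpace ℂ H₁] [NormedAddCommGroup H₂] [NormedSpace ℂ H₂]
  [NormedAddCommGroup Hp] [NormedSpace ℂ Hp] [NormedAddCommGroup Hm] [NormedSpace ℂ Hm]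

/-- The operator `(u, u₋) ↦ (P u + R₋ u₋, R₊ u)` from `H₁ ⊕ H₋` to `H₂ ⊕ H₊`. -/
def system (P : H₁ →L[ℂ] H₂) (Rm : Hm →L[ℂ] H₂) (Rp : H₁ →L[ℂ] Hp) :
    (H₁ × Hm) →L[ℂ] (H₂ × Hp) :=
  (P.coprod Rm).prod (Rp ∘L ContinuousLinearMap.fst ℂ H₁ Hm)

/-- The Grushin problem is well posed when its operator has a bounded two-sided inverse. -/
def IsWellPosed (P : H₁ →L[ℂ] H₂) (Rm : Hm →L[ℂ] H₂) (Rp : H₁ →L[ℂ] Hp) : Prop :=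
  (system P Rm Rp).IsInvertible

/-- The effective Hamiltonian `E₋₊ : H₊ → H₋`, the lower right entry of the inverse
`H₂ ⊕ H₊ → H₁ ⊕ H₋` (meaningful for a well posed problem). -/
def effectiveHamiltonian (P : H₁ →L[ℂ] H₂) (Rm : Hm →L[ℂ] H₂) (Rp : H₁ →L[ℂ] Hp) :
    Hp →L[ℂ] Hm :=
  ContinuousLinearMap.snd ℂ H₁ Hm ∘L (system P Rm Rp).inverse ∘L ContinuousLinearMap.inr ℂ H₂ Hp

end Problem

section Curves

variable {F : Type*} [NormedAddCommGroup F] [NormedSpace ℂ F]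

/-- The 1-form `f(z) dz` on `ℂ`, so that `∫ᶜ z in γ, dzForm f z` is `∫_γ f(z) dz`. -/
def dzForm (f : ℂ → F) (z : ℂ) : ℂ →L[ℂ] F :=
  ContinuousLinearMap.toSpanSingleton ℂ (f z)

/-- A path is piecewise `C¹`: there is a partition `0 = t₀ < t₁ < ⋯ < tₙ = 1` such that the path is
`C¹` on each closed interval `[tᵢ, tᵢ₊₁]` (one-sided derivatives at the end points). -/
def IsPiecewiseC1 {a b : ℂ} (γ : Path a b) : Prop :=
  ∃ (n : ℕ) (t : ℕ → ℝ), t 0 = 0 ∧ t n = 1 ∧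
    ∀ i < n, t i < t (i + 1) ∧ ContDiffOn ℝ 1 γ.extend (Set.Icc (t i) (t (i + 1)))

/-- The winding number of a closed curve around `w`. -/
def windingNumber {a : ℂ} (γ : Path a a) (w : ℂ) : ℂ :=
  (2 * Real.pi * Complex.I)⁻¹ * ∫ᶜ z in γ, dzForm (fun z => (z - w)⁻¹) z

/-- A closed curve is homologous to `0` in `Ω` when it lies in `Ω` and its winding number around
every point outside `Ω` is zero. -/
def IsNullHomologous {a : ℂ} (γ : Path a a) (Ω : Set ℂ) : Prop :=
  Set.range γ ⊆ Ω ∧ ∀ w, w ∉ Ω → windingNumber γ w = 0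

end Curves

end Grushin

end

/-! On `γ` the Schur complement formula gives `P⁻¹ = E - E₊ E₋₊⁻¹ E₋` (`inverse_eq`). The term `g Ṗ
E` is holomorphic in all of `Ω`, so its integral vanishes by Cauchy's theorem. The remaining
integrand factors through `H₋`, which is finite dimensional: `E₋ R₋ = 1` makes the finite rank
operator `R₋` injective. Likewise `R₊ E₊ = 1` makes `H₊` finite dimensional.

The range of the remaining integrand moves with `z`, so its integral need not have finite rank.
Bessel's inequality bounds the diagonal sums of its matrix coefficients uniformly, which gives both
the trace class property (`isTraceClass_integral_comp`) and the exchange of trace and integral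
(`hasTrace_integral_comp`).

By cyclicity it remains to integrate `-g tr (E₋ Ṗ E₊ E₋₊⁻¹)`. Differentiating `E₋ P + E₋₊ R₊ = 0`
and `E₋ R₋ = 1` yields `Ė₋₊` (`deriv_effectiveHamiltonian`), and the trace becomes `g tr (Ė₋₊ E₋₊⁻¹)
+ g (tr (Ṙ₊ E₊) + tr (E₋ Ṙ₋))`. The last bracket is holomorphic in `Ω`, so a second use of Cauchy's
theorem removes it. -/

noncomputable section

namespace Grushin

open Set Filter Topology MeasureTheory intervalIntegral Metric

/-! ### Integration along piecewise `C¹` paths -/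

section CurveIntegrals

variable {F : Type*} [NormedAddCommGroup F] [NormedSpace ℂ F]

/-- The velocity of a path in `ℂ`, as used by `curveIntegral`. -/
def velocity {a b : ℂ} (γ : Path a b) (t : ℝ) : ℂ :=
  derivWithin γ.extend (Icc 0 1) t

lemma curveIntegralFun_dzForm {a b : ℂ} (γ : Path a b) (f : ℂ → F) :
    curveIntegralFun (dzForm f) γ = fun t => velocity γ t • f (γ.extend t) := by
  funext t
  simp [curveIntegralFun_def, dzForm, velocity, unitInterval]

lemma curveIntegral_dzForm {a b : ℂ} (γ : Path a b) (f : ℂ → F) :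
    ∫ᶜ z in γ, dzForm f z = ∫ t in (0 : ℝ)..1, velocity γ t • f (γ.extend t) := by
  rw [curveIntegral_def, curveIntegralFun_dzForm]

lemma extend_mem_range {a b : ℂ} (γ : Path a b) (t : ℝ) : γ.extend t ∈ range γ := by
  rw [← γ.extend_range]; exact mem_range_self t

/-- The values of `t` beyond index `n` are unconstrained, so `Monotone t` is not available. -/
lemma partition_monotone {n : ℕ} {t : ℕ → ℝ} (h : ∀ i < n, t i < t (i + 1)) :
    ∀ j ≤ n, ∀ i ≤ j, t i ≤ t j := by
  intro j
  induction j with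
  | zero => intro _ i hi; rw [Nat.le_zero.1 hi]
  | succ k ih =>
    intro hk i hi
    rcases Nat.lt_or_eq_of_le hi with h1 | rfl
    · exact (ih (by omega) i (by omega)).trans (h k (by omega)).le
    · exact le_rfl

/-- A piecewise `C¹` path has an integrable velocity. -/
lemma IsPiecewiseC1.intervalIntegrable_velocity {a b : ℂ} {γ : Path a b} (hγ : IsPiecewiseC1 γ) :
    IntervalIntegrable (velocity γ) volume 0 1 := by
  obtain ⟨n, t, h0, h1, h⟩ := hγ
  have hmono := partition_monotone fun i hi => (h i hi).1
  have key : ∀ i < n, IntervalIntegrable (velocity γ) volume (t i) (t (i + 1)) := by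
    intro i hi
    obtain ⟨hlt, hC⟩ := h i hi
    have hc := hC.continuousOn_derivWithin (uniqueDiffOn_Icc hlt) le_rfl
    rw [← uIcc_of_le hlt.le] at hc
    -- Inside a partition interval both `derivWithin` are the ordinary derivative; the end points
    -- are a null set.
    refine hc.intervalIntegrable.congr_uIoo ?_
    intro x hx
    rw [uIoo_of_lt hlt] at hx
    have hx1 : x ∈ Ioo (0 : ℝ) 1 :=
      ⟨lt_of_le_of_lt (h0 ▸ hmono i hi.le 0 (Nat.zero_le _)) hx.1,
        lt_of_lt_of_le hx.2 (h1 ▸ hmono n le_rfl (i + 1) hi)⟩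
    simp only [velocity, uIcc_of_le hlt.le]
    rw [derivWithin_of_mem_nhds (Icc_mem_nhds hx.1 hx.2),
      derivWithin_of_mem_nhds (Icc_mem_nhds hx1.1 hx1.2)]
  have := IntervalIntegrable.trans_iterate key
  rwa [h0, h1] at this

/-- A piecewise `C¹` path is differentiable off a countable set. -/
lemma IsPiecewiseC1.exists_countable_hasDerivAt {a b : ℂ} {γ : Path a b} (hγ : IsPiecewiseC1 γ) :
    ∃ s : Set ℝ, s.Countable ∧ ∀ x ∈ Ioo (0 : ℝ) 1 \ s, HasDerivAt γ.extend (velocity γ x) x := by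
  obtain ⟨n, t, h0, h1, h⟩ := hγ
  refine ⟨range t, countable_range t, fun x hx => ?_⟩
  have : ∃ i < n, t i < x ∧ x < t (i + 1) := by
    by_contra! hcon
    have hlt : ∀ i ≤ n, t i < x := by
      intro i
      induction i with
      | zero => intro _; rw [h0]; exact hx.1.1
      | succ k ih =>
        intro hk
        refine lt_of_le_of_ne (hcon k (by omega) (ih (by omega))) fun e => hx.2 ⟨_, e⟩
    have := hlt n le_rfl
    rw [h1] at this
    exact lt_asymm this hx.1.2
  obtain ⟨i, hi, hix, hxi⟩ := this
  have hd : DifferentiableAt ℝ γ.extend x :=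
    ((h i hi).2.differentiableOn one_ne_zero).differentiableAt (Icc_mem_nhds hix hxi)
  rw [velocity, derivWithin_of_mem_nhds (Icc_mem_nhds hx.1.1 hx.1.2)]
  exact hd.hasDerivAt

lemma IsPiecewiseC1.intervalIntegrable_velocity_smul {a b : ℂ} {γ : Path a b}
    (hγ : IsPiecewiseC1 γ) {f : ℝ → F} (hf : Continuous f) :
    IntervalIntegrable (fun t => velocity γ t • f t) volume 0 1 :=
  hγ.intervalIntegrable_velocity.smul_continuousOn hf.continuousOn

lemma continuous_comp_extend {a b : ℂ} (γ : Path a b) {X : Type*} [TopologicalSpace X] {f : ℂ → X}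
    (hf : ContinuousOn f (range γ)) : Continuous fun t => f (γ.extend t) :=
  hf.comp_continuous γ.continuous_extend (extend_mem_range γ)

/-- The integral of a continuous function with a primitive along a closed curve vanishes. -/
lemma IsPiecewiseC1.integral_eq_zero_of_primitive [CompleteSpace F] {a : ℂ} {γ : Path a a}
    (hγ : IsPiecewiseC1 γ) {f G : ℂ → F} (hf : ContinuousOn f (range γ))
    (hG : ∀ z ∈ range γ, HasDerivAt G (f z) z) :
    ∫ t in (0 : ℝ)..1, velocity γ t • f (γ.extend t) = 0 := by
  obtain ⟨s, hs, hd⟩ := hγ.exists_countable_hasDerivAt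
  have hcont : Continuous fun t => G (γ.extend t) :=
    continuous_comp_extend γ fun z hz => (hG z hz).continuousAt.continuousWithinAt
  rw [MeasureTheory.integral_eq_of_hasDerivAt_off_countable_of_le
    (fun t => G (γ.extend t)) _ zero_le_one hs hcont.continuousOn
    (fun x hx => (hG _ (extend_mem_range γ x)).scomp x (hd x hx))
    (hγ.intervalIntegrable_velocity_smul (continuous_comp_extend γ hf))]
  simp

end CurveIntegrals

/-! ### Holomorphic dependence on a parameter -/

section ParametricIntegrals

variable {F : Type*} [NormedAddCommGroup F] [NormedSpace ℂ F]

/-- An integral depending holomorphically on a parameter, with a locally bounded integrand. -/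
lemma differentiableAt_integral_smul {φ : ℂ → ℝ → F} {c : ℝ → ℂ} {z₀ : ℂ} {r C : ℝ}
    (hc : IntervalIntegrable c volume 0 1) (hr : 0 < r)
    (hcont : ∀ z ∈ ball z₀ r, Continuous (φ z))
    (hdiff : ∀ t, DifferentiableOn ℂ (fun z => φ z t) (ball z₀ r))
    (hbound : ∀ z ∈ ball z₀ r, ∀ t, ‖φ z t‖ ≤ C) :
    DifferentiableAt ℂ (fun z => ∫ t in (0 : ℝ)..1, c t • φ z t) z₀ := by
  have hz₀ : z₀ ∈ ball z₀ r := mem_ball_self hr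
  have hC : 0 ≤ C := (norm_nonneg _).trans (hbound z₀ hz₀ 0)
  have hsub : ∀ z ∈ ball z₀ (r / 2), closedBall z (r / 4) ⊆ ball z₀ r := by
    intro z hz w hw
    rw [mem_ball] at hz ⊢
    rw [mem_closedBall] at hw
    linarith [dist_triangle w z z₀]
  have hder : ∀ z ∈ ball z₀ r, ∀ t, HasDerivAt (fun z => φ z t) (deriv (fun z => φ z t) z) z :=
    fun z hz t => ((hdiff t).differentiableAt (isOpen_ball.mem_nhds hz)).hasDerivAt
  -- Cauchy's estimate on disks of radius `r / 4` supplies the dominating function.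
  have hdb : ∀ z ∈ ball z₀ (r / 2), ∀ t, ‖deriv (fun z => φ z t) z‖ ≤ C / (r / 4) := by
    intro z hz t
    refine Complex.norm_deriv_le_of_forall_mem_sphere_norm_le (by positivity) ?_ ?_
    · refine DifferentiableOn.diffContOnCl ?_
      rw [closure_ball _ (by positivity)]
      exact (hdiff t).mono (hsub z hz)
    · intro w hw
      exact hbound w (hsub z hz (sphere_subset_closedBall hw)) t
  -- Measurability in `t` of the derivative: it is a pointwise limit of difference quotients along a
  -- sequence in the ball.
  have hdm : AEStronglyMeasurable (fun t => deriv (fun z => φ z t) z₀)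
      (volume.restrict (uIoc (0 : ℝ) 1)) := by
    have hlim : Tendsto (fun n : ℕ => z₀ + ((r / 2 : ℝ) : ℂ) * (1 / ((n : ℂ) + 1))) atTop
        (𝓝[≠] z₀) := by
      refine tendsto_nhdsWithin_iff.2 ⟨?_, Eventually.of_forall fun n => ?_⟩
      · have := (tendsto_one_div_add_atTop_nhds_zero_nat (𝕜 := ℂ)).const_mul ((r / 2 : ℝ) : ℂ)
        simpa using this.const_add z₀
      · have h1 : ((r / 2 : ℝ) : ℂ) ≠ 0 := by exact_mod_cast (by positivity : r / 2 ≠ 0)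
        have h2 : (n : ℂ) + 1 ≠ 0 := by exact_mod_cast Nat.succ_ne_zero n
        simp only [mem_compl_iff, mem_singleton_iff, add_eq_left]
        exact mul_ne_zero h1 (one_div_ne_zero h2)
    refine aestronglyMeasurable_of_tendsto_ae atTop
      (f := fun (n : ℕ) t => slope (fun z => φ z t) z₀
        (z₀ + ((r / 2 : ℝ) : ℂ) * (1 / ((n : ℂ) + 1)))) (fun n => ?_)
      (Eventually.of_forall fun t => (hasDerivAt_iff_tendsto_slope.1 (hder z₀ hz₀ t)).comp hlim)
    have hmem : z₀ + ((r / 2 : ℝ) : ℂ) * (1 / ((n : ℂ) + 1)) ∈ ball z₀ r := by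
      have h2 : ‖(1 : ℂ) / ((n : ℂ) + 1)‖ ≤ 1 := by
        rw [norm_div, norm_one]
        have : ‖(n : ℂ) + 1‖ = (n : ℝ) + 1 := by
          have := Complex.norm_natCast (n + 1); push_cast at this; exact this
        rw [this]
        exact (div_le_one (by positivity)).2 (by linarith [Nat.cast_nonneg (α := ℝ) n])
      rw [mem_ball, dist_eq_norm, add_sub_cancel_left, norm_mul, Complex.norm_real,
        Real.norm_of_nonneg (by positivity)]
      nlinarith
    simp only [slope_def_module]
    exact (((hcont _ hmem).sub (hcont _ hz₀)).const_smul _).aestronglyMeasurable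
  have hcm : AEStronglyMeasurable c (volume.restrict (uIoc (0 : ℝ) 1)) :=
    (intervalIntegrable_iff.1 hc).aestronglyMeasurable
  refine (intervalIntegral.hasDerivAt_integral_of_dominated_loc_of_deriv_le
    (F := fun z t => c t • φ z t) (F' := fun z t => c t • deriv (fun z => φ z t) z)
    (bound := fun t => ‖c t‖ * (C / (r / 4))) (ball_mem_nhds z₀ (half_pos hr)) ?_ ?_ ?_ ?_ ?_
    ?_).2.differentiableAt
  · filter_upwards [ball_mem_nhds z₀ hr] with z hz
    exact hcm.smul (hcont z hz).aestronglyMeasurable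
  · exact hc.smul_continuousOn (hcont z₀ hz₀).continuousOn
  · exact hcm.smul hdm
  · refine Eventually.of_forall fun t _ z hz => ?_
    rw [norm_smul]
    exact mul_le_mul_of_nonneg_left (hdb z hz t) (norm_nonneg _)
  · exact hc.norm.mul_const _
  · refine Eventually.of_forall fun t _ z hz => ?_
    exact (hder z (ball_subset_ball (by linarith) hz) t).const_smul (c t)

end ParametricIntegrals

/-! ### Winding numbers -/

section Winding

lemma integral_velocity_eq_windingNumber {a : ℂ} (γ : Path a a) (w : ℂ) :
    ∫ t in (0 : ℝ)..1, velocity γ t • (γ.extend t - w)⁻¹ =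
      2 * Real.pi * Complex.I * windingNumber γ w := by
  rw [windingNumber, curveIntegral_dzForm, mul_inv_cancel_left₀ Complex.two_pi_I_ne_zero]

/-- The winding number is constant near a point off the curve. -/
lemma IsPiecewiseC1.windingNumber_eq {a : ℂ} {γ : Path a a} (hγ : IsPiecewiseC1 γ) {z w : ℂ}
    (h : ∀ u ∈ range γ, dist z w < dist u w) : windingNumber γ z = windingNumber γ w := by
  have hw : ∀ u ∈ range γ, u - w ≠ 0 := fun u hu e => by
    have := h u hu
    rw [dist_eq_norm u w, e, norm_zero] at this
    exact absurd this (not_lt.2 dist_nonneg)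
  have hz : ∀ u ∈ range γ, u - z ≠ 0 := fun u hu e => by
    have := h u hu
    rw [sub_eq_zero.1 e] at this
    exact lt_irrefl _ this
  have hcw : ContinuousOn (fun u => (u - w)⁻¹) (range γ) :=
    (continuousOn_id.sub continuousOn_const).inv₀ hw
  have hcz : ContinuousOn (fun u => (u - z)⁻¹) (range γ) :=
    (continuousOn_id.sub continuousOn_const).inv₀ hz
  -- The primitive is `log ((u - z) / (u - w))`; its argument lies within distance `1` of `1`, so
  -- the principal branch works.
  have h0 := hγ.integral_eq_zero_of_primitive (f := fun u => (u - z)⁻¹ - (u - w)⁻¹)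
    (G := fun u => Complex.log (1 + (w - z) * (u - w)⁻¹)) (hcz.sub hcw) fun u hu => by
      have hlt : ‖(w - z) * (u - w)⁻¹‖ < 1 := by
        have := h u hu
        rw [dist_comm z w, dist_eq_norm, dist_eq_norm] at this
        rw [norm_mul, norm_inv, ← div_eq_mul_inv]
        exact (div_lt_one (norm_pos_iff.2 (hw u hu))).2 this
      have hd : HasDerivAt (fun u => 1 + (w - z) * (u - w)⁻¹)
          ((w - z) * (-1 / (u - w) ^ 2)) u :=
        ((((hasDerivAt_id u).sub_const w).inv (hw u hu)).const_mul (w - z)).const_add 1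
      refine (hd.clog (Complex.mem_slitPlane_of_norm_lt_one hlt)).congr_deriv ?_
      have h1 := hw u hu
      have h2 := hz u hu
      have h3 : 1 + (w - z) * (u - w)⁻¹ = (u - z) / (u - w) := by field_simp; ring
      rw [h3]
      field_simp
      ring
  simp only [smul_sub] at h0
  rw [intervalIntegral.integral_sub
    (hγ.intervalIntegrable_velocity_smul (continuous_comp_extend γ hcz))
    (hγ.intervalIntegrable_velocity_smul (continuous_comp_extend γ hcw)),
    integral_velocity_eq_windingNumber, integral_velocity_eq_windingNumber, ← mul_sub] at h0
  exact sub_eq_zero.1 ((mul_eq_zero.1 h0).resolve_left Complex.two_pi_I_ne_zero)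

/-- The winding number vanishes at points far away from the curve. -/
lemma IsPiecewiseC1.windingNumber_eq_zero {a : ℂ} {γ : Path a a} (hγ : IsPiecewiseC1 γ) {z : ℂ}
    (h : ∀ u ∈ range γ, ‖u‖ < ‖z‖) : windingNumber γ z = 0 := by
  have hz0 : z ≠ 0 := by
    rintro rfl
    exact absurd (h _ (mem_range_self 0)) (by simp)
  have hz : ∀ u ∈ range γ, u - z ≠ 0 := fun u hu e => by
    have := h u hu
    rw [sub_eq_zero.1 e] at this
    exact lt_irrefl _ this
  have hcz : ContinuousOn (fun u => (u - z)⁻¹) (range γ) :=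
    (continuousOn_id.sub continuousOn_const).inv₀ hz
  have h0 := hγ.integral_eq_zero_of_primitive (f := fun u => (u - z)⁻¹)
    (G := fun u => Complex.log (1 + -z⁻¹ * u)) hcz fun u hu => by
      have hlt : ‖-z⁻¹ * u‖ < 1 := by
        rw [norm_mul, norm_neg, norm_inv, mul_comm, ← div_eq_mul_inv]
        exact (div_lt_one (norm_pos_iff.2 hz0)).2 (h u hu)
      have hd : HasDerivAt (fun u => 1 + -z⁻¹ * u) (-z⁻¹ * 1) u :=
        ((hasDerivAt_id u).const_mul (-z⁻¹)).const_add 1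
      refine (hd.clog (Complex.mem_slitPlane_of_norm_lt_one hlt)).congr_deriv ?_
      have h2 := hz u hu
      have h3 : 1 + -z⁻¹ * u = -z⁻¹ * (u - z) := by field_simp; ring
      rw [h3]
      field_simp
  rw [integral_velocity_eq_windingNumber] at h0
  exact (mul_eq_zero.1 h0).resolve_left Complex.two_pi_I_ne_zero

end Winding

/-! ### Cauchy's theorem in homology form -/

section Cauchy

variable {F : Type*} [NormedAddCommGroup F] [NormedSpace ℂ F]

/-- A function which is holomorphic near a closed disk has difference quotients that are bounded
uniformly with respect to base points in a smaller disk and in a compact set. -/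
lemma exists_norm_dslope_le [CompleteSpace F] {f : ℂ → F} {Ω K : Set ℂ} (hΩ : IsOpen Ω)
    (hf : DifferentiableOn ℂ f Ω) (hK : IsCompact K) (hKΩ : K ⊆ Ω) {z₀ : ℂ} {R : ℝ} (hR : 0 < R)
    (hball : closedBall z₀ R ⊆ Ω) :
    ∃ C, ∀ w ∈ K, ∀ z ∈ ball z₀ (R / 4), ‖dslope f w z‖ ≤ C := by
  obtain ⟨M, hM⟩ := (hK.union (isCompact_closedBall z₀ R)).exists_bound_of_continuousOn
    (hf.continuousOn.mono (union_subset hKΩ hball))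
  have hquot : ∀ w ∈ K, ∀ z ∈ closedBall z₀ R, R / 4 ≤ ‖z - w‖ →
      ‖dslope f w z‖ ≤ (M + M) / (R / 4) := by
    intro w hw z hz hzw
    have hne : z ≠ w := by
      rintro rfl
      rw [sub_self, norm_zero] at hzw
      linarith
    rw [dslope_of_ne _ hne, slope_def_module, norm_smul, norm_inv, div_eq_inv_mul]
    have h1 := hM w (Or.inl hw)
    have h2 := hM z (Or.inr hz)
    have h3 : ‖f z - f w‖ ≤ M + M := (norm_sub_le _ _).trans (add_le_add h2 h1)
    gcongr
  refine ⟨(M + M) / (R / 4), fun w hw z hz => ?_⟩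
  -- If `w` is near `z₀`, the maximum principle reduces to the circle of radius `R`, which is at
  -- distance at least `R / 2` from `w`. Otherwise `z` itself is at distance at least `R / 4` from
  -- `w`.
  by_cases hwz : dist w z₀ ≤ R / 2
  · refine Complex.norm_le_of_forall_mem_frontier_norm_le (U := ball z₀ R) isBounded_ball ?_ ?_
      (subset_closure (ball_subset_ball (by linarith) hz))
    · refine DifferentiableOn.diffContOnCl ?_
      rw [closure_ball _ hR.ne']
      exact ((Complex.differentiableOn_dslope (hΩ.mem_nhds (hKΩ hw))).2 hf).mono hball
    · intro u hu
      rw [frontier_ball _ hR.ne'] at hu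
      refine hquot w hw u (sphere_subset_closedBall hu) ?_
      rw [mem_sphere] at hu
      rw [← dist_eq_norm]
      linarith [dist_triangle u w z₀]
  · refine hquot w hw z (ball_subset_closedBall (ball_subset_ball (by linarith) hz)) ?_
    rw [mem_ball] at hz
    rw [← dist_eq_norm]
    linarith [dist_triangle w z z₀, dist_comm w z]

/-- Exchanging base point and variable turns holomorphy in the variable into holomorphy in the base
point. -/
lemma dslope_comm (f : ℂ → F) (z w : ℂ) : dslope f z w = dslope f w z := by
  rcases eq_or_ne z w with rfl | h
  · rfl
  · rw [dslope_of_ne _ h.symm, dslope_of_ne _ h, slope_comm]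

/-- **Cauchy's theorem**, homology version: the integral of a holomorphic function along a curve
which is homologous to `0` vanishes. The proof is Dixon's. -/
theorem IsPiecewiseC1.integral_eq_zero [CompleteSpace F] {Ω : Set ℂ} (hΩ : IsOpen Ω) {a : ℂ}
    {γ : Path a a} (hγ : IsPiecewiseC1 γ) (hγ₀ : IsNullHomologous γ Ω) {f : ℂ → F}
    (hf : DifferentiableOn ℂ f Ω) :
    ∫ t in (0 : ℝ)..1, velocity γ t • f (γ.extend t) = 0 := by
  classical
  have hK : IsCompact (range γ) := isCompact_range γ.continuous
  have haΩ : a ∈ Ω := hγ₀.1 ⟨0, γ.source⟩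
  -- With the factor `w - a`, the difference quotient of `G` at `a` is `f`, so `h₁ a` below is the
  -- integral to be computed.
  set G : ℂ → F := fun w => (w - a) • f w with hG
  have hGd : DifferentiableOn ℂ G Ω :=
    (differentiableOn_id.sub (differentiableOn_const a)).smul hf
  have hGc : ContinuousOn G (range γ) := hGd.continuousOn.mono hγ₀.1
  set h₁ : ℂ → F := fun z => ∫ t in (0 : ℝ)..1, velocity γ t • dslope G z (γ.extend t) with hh₁
  set h₂ : ℂ → F := fun z => ∫ t in (0 : ℝ)..1,
    velocity γ t • ((γ.extend t - z)⁻¹ • G (γ.extend t)) with hh₂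
  have hdc : ∀ z ∈ Ω, Continuous fun t => dslope G z (γ.extend t) := fun z hz =>
    continuous_comp_extend γ (((continuousOn_dslope (hΩ.mem_nhds hz)).2 ⟨hGd.continuousOn,
      hGd.differentiableAt (hΩ.mem_nhds hz)⟩).mono hγ₀.1)
  have hd₁ : ∀ z ∈ Ω, DifferentiableAt ℂ h₁ z := by
    intro z₀ hz₀
    obtain ⟨R, hR, hball⟩ := nhds_basis_closedBall.mem_iff.1 (hΩ.mem_nhds hz₀)
    obtain ⟨C, hC⟩ := exists_norm_dslope_le hΩ hGd hK hγ₀.1 hR hball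
    have hsub : ball z₀ (R / 4) ⊆ Ω := fun z hz =>
      hball (ball_subset_closedBall (ball_subset_ball (by linarith) hz))
    refine differentiableAt_integral_smul (C := C) hγ.intervalIntegrable_velocity
      (by positivity : 0 < R / 4) (fun z hz => hdc z (hsub hz)) (fun t => ?_) fun z hz t => ?_
    · simp only [dslope_comm G _ (γ.extend t)]
      exact ((Complex.differentiableOn_dslope
        (hΩ.mem_nhds (hγ₀.1 (extend_mem_range γ t)))).2 hGd).mono hsub
    · rw [dslope_comm]
      exact hC _ (extend_mem_range γ t) z hz
  obtain ⟨M, hM⟩ := hK.exists_bound_of_continuousOn hGc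
  have hkc : ∀ z ∉ range γ, Continuous fun t => (γ.extend t - z)⁻¹ := fun z hz =>
    continuous_comp_extend γ (f := fun u => (u - z)⁻¹)
      ((continuousOn_id.sub continuousOn_const).inv₀ fun u hu e => by
        have e' : u = z := sub_eq_zero.1 e
        exact hz (e' ▸ hu))
  have hGc' := continuous_comp_extend γ hGc
  have hfar : ∀ z₀ ∉ range γ, ∃ r > 0, ∀ z ∈ ball z₀ r, ∀ u ∈ range γ, r ≤ dist u z := by
    intro z₀ hz₀
    obtain ⟨r, hr, hball⟩ := nhds_basis_ball.mem_iff.1 (hK.isClosed.isOpen_compl.mem_nhds hz₀)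
    refine ⟨r / 2, half_pos hr, fun z hz u hu => ?_⟩
    by_contra! hlt
    have hu' : u ∈ ball z₀ r := by
      rw [mem_ball] at hz ⊢
      linarith [dist_triangle u z z₀]
    exact hball hu' hu
  have hd₂ : ∀ z ∉ range γ, DifferentiableAt ℂ h₂ z := by
    intro z₀ hz₀
    obtain ⟨r, hr, hd⟩ := hfar z₀ hz₀
    have hne : ∀ z ∈ ball z₀ r, ∀ u ∈ range γ, u - z ≠ 0 := by
      intro z hz u hu e
      have := hd z hz u hu
      rw [dist_eq_norm, e, norm_zero] at this
      linarith
    refine differentiableAt_integral_smul (C := r⁻¹ * M) hγ.intervalIntegrable_velocity hr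
      (fun z hz => ?_) (fun t => ?_) fun z hz t => ?_
    · exact (hkc z fun hzr => hne z hz z hzr (sub_self z)).smul hGc'
    · exact (DifferentiableOn.inv ((differentiableOn_const _).sub differentiableOn_id)
        fun z hz => hne z hz _ (extend_mem_range γ t)).smul_const _
    · rw [norm_smul, norm_inv, ← dist_eq_norm]
      exact mul_le_mul (inv_anti₀ hr (hd z hz _ (extend_mem_range γ t)))
        (hM _ (extend_mem_range γ t)) (norm_nonneg _) (by positivity)
  -- Off the curve, `h₁ z` and `h₂ z` differ by `2πi` times the winding number times `G z`.
  have hagree : ∀ z ∈ Ω, z ∉ range γ → windingNumber γ z = 0 → h₁ z = h₂ z := by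
    intro z hz hzγ hwz
    have e : ∀ t, velocity γ t • dslope G z (γ.extend t) =
        velocity γ t • ((γ.extend t - z)⁻¹ • G (γ.extend t)) -
          (velocity γ t • (γ.extend t - z)⁻¹) • G z := by
      intro t
      have hne : γ.extend t ≠ z := fun e => hzγ (e ▸ extend_mem_range γ t)
      rw [dslope_of_ne _ hne, slope_def_module, smul_sub, smul_sub, smul_assoc]
    simp only [hh₁, hh₂, e]
    have hi : IntervalIntegrable
        (fun t => velocity γ t • ((γ.extend t - z)⁻¹ • G (γ.extend t))) volume 0 1 :=
      hγ.intervalIntegrable_velocity_smul ((hkc z hzγ).smul hGc')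
    rw [intervalIntegral.integral_sub hi
      ((hγ.intervalIntegrable_velocity_smul (hkc z hzγ)).smul_continuousOn continuousOn_const),
      intervalIntegral.integral_smul_const, integral_velocity_eq_windingNumber, hwz]
    simp
  set h : ℂ → F := fun z => if z ∈ Ω then h₁ z else h₂ z with hh
  have hdiff : Differentiable ℂ h := by
    intro z₀
    by_cases hz₀ : z₀ ∈ Ω
    · refine (hd₁ z₀ hz₀).congr_of_eventuallyEq ?_
      filter_upwards [hΩ.mem_nhds hz₀] with z hz
      simp [hh, hz]
    · have hz₀γ : z₀ ∉ range γ := fun hz => hz₀ (hγ₀.1 hz)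
      refine (hd₂ z₀ hz₀γ).congr_of_eventuallyEq ?_
      obtain ⟨r, hr, hd⟩ := hfar z₀ hz₀γ
      filter_upwards [ball_mem_nhds z₀ hr] with z hz
      by_cases hzΩ : z ∈ Ω
      -- The winding number vanishes at `z₀ ∉ Ω` and is locally constant, so the two definitions of
      -- `h` agree near `z₀`.
      · have hw : windingNumber γ z = 0 := by
          rw [hγ.windingNumber_eq (w := z₀) fun u hu => lt_of_lt_of_le hz
            (hd z₀ (mem_ball_self hr) u hu)]
          exact hγ₀.2 z₀ hz₀
        have hzγ : z ∉ range γ := fun hzr => by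
          have := hd z hz z hzr
          rw [dist_self] at this
          linarith
        simp [hh, hzΩ, hagree z hzΩ hzγ hw]
      · simp [hh, hzΩ]
  have hlim : Tendsto h (cocompact ℂ) (𝓝 0) := by
    obtain ⟨B, hB⟩ := hK.isBounded.exists_norm_le
    have hM0 : 0 ≤ M := (norm_nonneg _).trans (hM _ (mem_range_self 0))
    set V := ∫ t in (0 : ℝ)..1, ‖velocity γ t‖ with hV
    have hb : ∀ᶠ z in cocompact ℂ, ‖h z‖ ≤ V * ((‖z‖ - B)⁻¹ * M) := by
      filter_upwards [(tendsto_norm_cocompact_atTop (E := ℂ)).eventually (eventually_gt_atTop B)]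
        with z hz
      have hzγ : z ∉ range γ := fun hzr => absurd (hB z hzr) (not_le.2 hz)
      have hzh : h z = h₂ z := by
        by_cases hzΩ : z ∈ Ω
        · simp only [hh, hzΩ, if_true]
          exact hagree z hzΩ hzγ
            (hγ.windingNumber_eq_zero fun u hu => (hB u hu).trans_lt hz)
        · simp [hh, hzΩ]
      rw [hzh, hV, ← intervalIntegral.integral_mul_const]
      refine intervalIntegral.norm_integral_le_of_norm_le zero_le_one
        (Eventually.of_forall fun t _ => ?_)
        (hγ.intervalIntegrable_velocity.norm.mul_const _)
      rw [norm_smul, norm_smul, norm_inv]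
      have h1 : ‖z‖ - B ≤ ‖γ.extend t - z‖ := by
        rw [norm_sub_rev]
        linarith [norm_sub_norm_le z (γ.extend t), hB _ (extend_mem_range γ t)]
      have h2 : 0 < ‖z‖ - B := by linarith
      have h3 := hM _ (extend_mem_range γ t)
      gcongr
    refine squeeze_zero_norm' hb ?_
    have h1 : Tendsto (fun z : ℂ => ‖z‖ - B) (cocompact ℂ) atTop :=
      tendsto_atTop_add_const_right _ _ (tendsto_norm_cocompact_atTop (E := ℂ))
    simpa using ((tendsto_inv_atTop_zero.comp h1).mul_const M).const_mul V
  -- Liouville: an entire function tending to `0` at infinity is zero.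
  have h0 : h a = 0 := hdiff.apply_eq_of_tendsto_cocompact a hlim
  have hfG : ∀ t, dslope G a (γ.extend t) = f (γ.extend t) := by
    intro t
    rcases eq_or_ne (γ.extend t) a with e | e
    · rw [e, dslope_same]
      have : HasDerivAt G _ a := ((hasDerivAt_id a).sub_const a).smul
        (hf.differentiableAt (hΩ.mem_nhds haΩ)).hasDerivAt
      simpa using this.deriv
    · rw [dslope_of_ne _ e, slope_def_module]
      simp [hG, smul_smul, inv_mul_cancel₀ (sub_ne_zero.2 e)]
  simpa [hh, haΩ, hh₁, hfG] using h0

end Cauchy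

/-! ### Spectral theory and a trace class criterion -/

section Spectral

variable {H K : Type*} [NormedAddCommGroup H] [InnerProductSpace ℂ H] [CompleteSpace H]
  [NormedAddCommGroup K] [InnerProductSpace ℂ K] [CompleteSpace K]

/-- A compact symmetric operator has an orthonormal basis of eigenvectors. -/
lemma exists_hilbertBasis_eigenvectors {A : K →L[ℂ] K} (hc : IsCompactOperator A)
    (hs : (A : K →ₗ[ℂ] K).IsSymmetric) :
    ∃ (s : Set K) (b : HilbertBasis s ℂ K) (ν : s → ℂ), ∀ i, A (b i) = ν i • b i := by
  have hcl : ∀ μ : ℂ, CompleteSpace (Module.End.eigenspace (A : K →ₗ[ℂ] K) μ) := by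
    intro μ
    have : IsClosed (Module.End.eigenspace (A : K →ₗ[ℂ] K) μ : Set K) := by
      have h : (Module.End.eigenspace (A : K →ₗ[ℂ] K) μ : Set K) = {x | A x = μ • x} := by
        ext x; simp
      rw [h]
      exact isClosed_eq A.continuous (continuous_const_smul μ)
    exact this.completeSpace_coe
  choose w b hb using fun μ : ℂ => exists_hilbertBasis ℂ (Module.End.eigenspace (A : K →ₗ[ℂ] K) μ)
  have hon := hs.orthogonalFamily_eigenspaces.orthonormal_sigma_orthonormal
    (v_family := fun μ => b μ) fun μ => (b μ).orthonormal
  set v : (Σ μ, w μ) → K :=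
    fun a => (Module.End.eigenspace (A : K →ₗ[ℂ] K) a.1).subtypeₗᵢ (b a.1 a.2) with hv
  have hperp : (Submodule.span ℂ (range ((↑) : range v → K)))ᗮ = ⊥ := by
    rw [Subtype.range_coe, eq_bot_iff,
      ← ContinuousLinearMap.orthogonalComplement_iSup_eigenspaces_eq_bot hc hs]
    intro x hx
    rw [Submodule.mem_orthogonal] at hx
    rw [← Submodule.iInf_orthogonal, Submodule.mem_iInf]
    intro μ
    have := hcl μ
    have hp : (Module.End.eigenspace (A : K →ₗ[ℂ] K) μ).orthogonalProjectionOnto x = 0 := by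
      refine (b μ).repr.injective ?_
      ext i
      rw [map_zero, HilbertBasis.repr_apply_apply]
      have := hx (v ⟨μ, i⟩) (Submodule.subset_span ⟨_, rfl⟩)
      simpa [hv] using this
    rw [Submodule.mem_orthogonal]
    intro y hy
    have h1 := Submodule.inner_orthogonalProjectionOnto_eq_of_mem_left ⟨y, hy⟩ x
    rw [hp] at h1
    simpa using h1.symm
  refine ⟨range v, HilbertBasis.mkOfOrthogonalEqBot hon.toSubtypeRange hperp,
    fun i => i.2.choose.1, fun i => ?_⟩
  rw [HilbertBasis.coe_mkOfOrthogonalEqBot]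
  have h1 : A (v i.2.choose) = i.2.choose.1 • v i.2.choose :=
    Module.End.mem_eigenspace_iff.1 (b i.2.choose.1 i.2.choose.2).2
  rwa [i.2.choose_spec] at h1

/-- The square root of a positive operator acts on its eigenvectors by the square root of the
eigenvalue. -/
lemma sqrt_apply_of_eigenvector {A : K →L[ℂ] K} (hA : 0 ≤ A) {x : K} {ν : ℝ} (hν : 0 ≤ ν)
    (hx : A x = (ν : ℂ) • x) : CFC.sqrt A x = ((√ν : ℝ) : ℂ) • x := by
  set S := CFC.sqrt A with hS
  have hSpos : S.IsPositive := (ContinuousLinearMap.nonneg_iff_isPositive _).1 (CFC.sqrt_nonneg A)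
  have hSS : ∀ y, S (S y) = A y := fun y => by
    have := CFC.sqrt_mul_sqrt_self A hA
    rw [← hS] at this
    exact congrArg (fun B : K →L[ℂ] K => B y) this
  have hsq : ((√ν : ℝ) : ℂ) * ((√ν : ℝ) : ℂ) = ν := by
    rw [← Complex.ofReal_mul, Real.mul_self_sqrt hν]
  rw [← sub_eq_zero]
  set y := S x - ((√ν : ℝ) : ℂ) • x with hy
  -- This is `(S - √ν)(S + √ν) x = 0`. Positivity of `S` excludes the eigenvalue `-√ν < 0`; the case
  -- `ν = 0` is treated separately.
  have hSy : S y = -(((√ν : ℝ) : ℂ) • y) := by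
    rw [hy, map_sub, map_smul, hSS, hx, smul_sub, smul_smul, hsq]
    abel
  rcases (Real.sqrt_nonneg ν).eq_or_lt with h0 | hpos
  · have hSx : ⟪S x, S x⟫_ℂ = 0 := by
      have h1 : ⟪S x, S x⟫_ℂ = ⟪x, S (S x)⟫_ℂ := hSpos.1 x (S x)
      rw [h1, hSS, hx, ← hsq, ← h0]
      simp
    rw [hy, inner_self_eq_zero.1 hSx, ← h0]
    simp
  · have h1 := hSpos.2 y
    rw [ContinuousLinearMap.reApplyInnerSelf, hSy, inner_neg_left, inner_smul_left,
      Complex.conj_ofReal, inner_self_eq_norm_sq_to_K] at h1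
    have h2 : 0 ≤ -(√ν * ‖y‖ ^ 2) := by
      have h3 : RCLike.re (-(((√ν : ℝ) : ℂ) * ((‖y‖ : ℝ) : ℂ) ^ 2)) = -(√ν * ‖y‖ ^ 2) := by
        rw [← Complex.ofReal_pow, ← Complex.ofReal_mul, ← Complex.ofReal_neg]
        exact Complex.ofReal_re _
      rw [← h3]
      exact h1
    have h4 : ‖y‖ ^ 2 ≤ 0 := by
      by_contra! h5
      linarith [mul_pos hpos h5]
    exact norm_eq_zero.1 (pow_eq_zero_iff two_ne_zero |>.1 (le_antisymm h4 (sq_nonneg _)))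

/-- A compact operator whose matrix coefficients with respect to orthonormal families have bounded
diagonal sums is of trace class. -/
lemma isTraceClass_of_sum_le {T : H →L[ℂ] K} (hT : IsCompactOperator T) {C : ℝ}
    (hC : ∀ (s : Set K) (u : s → H) (v : s → K), Orthonormal ℂ u → Orthonormal ℂ v →
      ∀ Φ : Finset s, ∑ i ∈ Φ, ‖⟪v i, T (u i)⟫_ℂ‖ ≤ C) :
    IsTraceClass T := by
  set A := T ∘L ContinuousLinearMap.adjoint T with hA
  have hApos : A.IsPositive := T.isPositive_self_comp_adjoint
  have hinner : ∀ x y, ⟪x, A y⟫_ℂ =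
      ⟪ContinuousLinearMap.adjoint T x, ContinuousLinearMap.adjoint T y⟫_ℂ := fun x y => by
    rw [ContinuousLinearMap.adjoint_inner_left]
    rfl
  obtain ⟨s, b, ν, hν⟩ : ∃ (s : Set K) (b : HilbertBasis s ℂ K) (ν : s → ℂ),
      ∀ i, A (b i) = ν i • b i := exists_hilbertBasis_eigenvectors
    (hT.comp_clm (ContinuousLinearMap.adjoint T)) hApos.1
  have hνval : ∀ i, ν i = ((‖ContinuousLinearMap.adjoint T (b i)‖ ^ 2 : ℝ) : ℂ) := by
    intro i
    have h1 := hinner (b i) (b i)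
    rw [hν, inner_smul_right, inner_self_eq_norm_sq_to_K, inner_self_eq_norm_sq_to_K,
      b.orthonormal.1 i] at h1
    simpa using h1
  set μ : s → ℝ := fun i => ‖ContinuousLinearMap.adjoint T (b i)‖ with hμ
  refine ⟨s, b, μ, fun i => ?_, ?_⟩
  · rw [sqrt_apply_of_eigenvector ((ContinuousLinearMap.nonneg_iff_isPositive _).2 hApos)
      (sq_nonneg (μ i)) (by rw [hν, hνval]), Real.sqrt_sq (norm_nonneg _)]
  -- Polar decomposition by hand: the vectors `uᵢ = μᵢ⁻¹ T* bᵢ` are orthonormal and `⟪bᵢ, T uᵢ⟫ =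
  -- μᵢ`, so the hypothesis bounds the sums of eigenvalues.
  · have hon : Orthonormal ℂ fun i : {i : s // μ i ≠ 0} =>
        ((μ i)⁻¹ : ℂ) • ContinuousLinearMap.adjoint T (b i) := by
      classical
      rw [orthonormal_iff_ite]
      intro i j
      rw [inner_smul_left, inner_smul_right, ← hinner, hν, inner_smul_right,
        orthonormal_iff_ite.1 b.orthonormal]
      by_cases hij : i = j
      · subst hij
        have h2 : (μ i : ℂ) ≠ 0 := by exact_mod_cast i.2
        rw [hνval, if_pos rfl, if_pos rfl, map_inv₀, Complex.conj_ofReal]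
        change (μ i : ℂ)⁻¹ * ((μ i : ℂ)⁻¹ * (((μ i ^ 2 : ℝ) : ℂ) * 1)) = 1
        push_cast
        field_simp
      · rw [if_neg hij, if_neg fun e => hij (Subtype.ext e)]
        simp
    have hval : ∀ i : {i : s // μ i ≠ 0},
        ⟪b i, T (((μ i)⁻¹ : ℂ) • ContinuousLinearMap.adjoint T (b i))⟫_ℂ = μ i := by
      intro i
      have h2 : (μ i : ℂ) ≠ 0 := by exact_mod_cast i.2
      have h3 : T (ContinuousLinearMap.adjoint T (b i)) = A (b i) := rfl
      rw [map_smul, h3, inner_smul_right, hν, inner_smul_right, inner_self_eq_norm_sq_to_K,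
        b.orthonormal.1, hνval]
      change (μ i : ℂ)⁻¹ * (((μ i ^ 2 : ℝ) : ℂ) * _) = μ i
      push_cast
      field_simp
    have hinj : Function.Injective fun i : {i : s // μ i ≠ 0} => (i : s) :=
      Subtype.val_injective
    rw [← hinj.summable_iff fun i hi => by
      by_contra hne
      exact hi ⟨⟨i, hne⟩, rfl⟩]
    refine summable_of_sum_le (c := C) (fun i => norm_nonneg _) fun Φ => ?_
    have hb' : Orthonormal ℂ fun i : {i : s // μ i ≠ 0} => b i :=
      b.orthonormal.comp _ hinj
    -- The hypothesis only covers families indexed by subsets of `K`.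
    let σ : Set K := (fun i : {i : s // μ i ≠ 0} => ((i : s) : K)) '' univ
    have hσinj : Function.Injective fun i : {i : s // μ i ≠ 0} => ((i : s) : K) :=
      Subtype.val_injective.comp hinj
    let e : {i : s // μ i ≠ 0} ≃ σ :=
      (Equiv.Set.univ _).symm.trans (Equiv.Set.image _ univ hσinj)
    have := hC σ _ _ (hon.comp e.symm e.symm.injective) (hb'.comp e.symm e.symm.injective)
      (Φ.map e.toEmbedding)
    rw [Finset.sum_map] at this
    refine le_trans (Finset.sum_le_sum fun i _ => ?_) this
    simp only [Function.comp_apply, Equiv.coe_toEmbedding, Equiv.symm_apply_apply]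
    rw [hval, Complex.norm_real]
    exact le_abs_self _

end Spectral

/-! ### Trace class integrals through a finite dimensional space -/

section Integrals

set_option linter.unusedSectionVars false

/-- An interval integral of a function with values in a closed subspace lies in the subspace. -/
lemma intervalIntegral_mem_of_isClosed {E : Type*} [NormedAddCommGroup E] [NormedSpace ℂ E]
    [CompleteSpace E] {S : Submodule ℂ E} (hS : IsClosed (S : Set E)) {f : ℝ → E} {a b : ℝ}
    (hf : IntervalIntegrable f volume a b) (hmem : ∀ t, f t ∈ S) : ∫ t in a..b, f t ∈ S := by
  have : IsClosed (S : Set E) := hS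
  have h := S.mkQL.intervalIntegral_comp_comm hf
  have h0 : ∀ t, S.mkQL (f t) = 0 := fun t => (Submodule.Quotient.mk_eq_zero S).2 (hmem t)
  simp only [h0, intervalIntegral.integral_zero] at h
  exact (Submodule.Quotient.mk_eq_zero S).1 h.symm

variable {H K F : Type*} [NormedAddCommGroup H] [InnerProductSpace ℂ H] [CompleteSpace H]
  [NormedAddCommGroup K] [InnerProductSpace ℂ K] [CompleteSpace K]
  [NormedAddCommGroup F] [InnerProductSpace ℂ F] [FiniteDimensional ℂ F]

/-- A continuous bound for diagonal sums of matrix coefficients of the product `A B`. -/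
def traceBound (A : F →L[ℂ] K) (B : H →L[ℂ] F) : ℝ :=
  ∑ j, (‖A (stdOrthonormalBasis ℂ F j)‖ ^ 2 +
    ‖ContinuousLinearMap.adjoint B (stdOrthonormalBasis ℂ F j)‖ ^ 2)

/-- Expanding `B u` in a basis of `F` separates `u` from `v`, so that Bessel's inequality applies to
each factor. -/
lemma inner_comp_apply (A : F →L[ℂ] K) (B : H →L[ℂ] F) (u : H) (v : K) :
    ⟪v, A (B u)⟫_ℂ = ∑ j, ⟪v, A (stdOrthonormalBasis ℂ F j)⟫_ℂ *
      ⟪ContinuousLinearMap.adjoint B (stdOrthonormalBasis ℂ F j), u⟫_ℂ := by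
  conv_lhs => rw [← (stdOrthonormalBasis ℂ F).sum_repr' (B u)]
  rw [map_sum, inner_sum]
  refine Finset.sum_congr rfl fun j _ => ?_
  rw [map_smul, inner_smul_right, ContinuousLinearMap.adjoint_inner_left, mul_comm]

lemma sum_norm_inner_comp_le (A : F →L[ℂ] K) (B : H →L[ℂ] F) {ι : Type*} {u : ι → H} {v : ι → K}
    (hu : Orthonormal ℂ u) (hv : Orthonormal ℂ v) (Φ : Finset ι) :
    ∑ i ∈ Φ, ‖⟪v i, A (B (u i))⟫_ℂ‖ ≤ traceBound A B := by
  simp only [inner_comp_apply A B]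
  refine (Finset.sum_le_sum fun i _ => norm_sum_le _ _).trans ?_
  rw [Finset.sum_comm, traceBound]
  refine Finset.sum_le_sum fun j _ => ?_
  have h1 := hv.sum_inner_products_le (s := Φ) (A (stdOrthonormalBasis ℂ F j))
  have h2 := hu.sum_inner_products_le (s := Φ)
    (ContinuousLinearMap.adjoint B (stdOrthonormalBasis ℂ F j))
  refine le_trans ?_ (add_le_add h1 h2)
  rw [← Finset.sum_add_distrib]
  refine Finset.sum_le_sum fun i _ => ?_
  rw [norm_mul, norm_inner_symm (ContinuousLinearMap.adjoint B _)]
  nlinarith [sq_nonneg (‖⟪v i, A (stdOrthonormalBasis ℂ F j)⟫_ℂ‖ -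
    ‖⟪u i, ContinuousLinearMap.adjoint B (stdOrthonormalBasis ℂ F j)⟫_ℂ‖),
    norm_nonneg ⟪v i, A (stdOrthonormalBasis ℂ F j)⟫_ℂ,
    norm_nonneg ⟪u i, ContinuousLinearMap.adjoint B (stdOrthonormalBasis ℂ F j)⟫_ℂ]

lemma continuous_traceBound {A : ℝ → F →L[ℂ] K} {B : ℝ → H →L[ℂ] F} (hA : Continuous A)
    (hB : Continuous B) : Continuous fun t => traceBound (A t) (B t) := by
  unfold traceBound
  have := (ContinuousLinearMap.adjoint (𝕜 := ℂ) (E := H) (F := F)).continuous.comp hB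
  refine continuous_finsetSum _ fun j _ => ?_
  exact ((hA.clm_apply continuous_const).norm.pow 2).add
    ((this.clm_apply continuous_const).norm.pow 2)

/-- The trace of a product through a finite dimensional space. -/
lemma hasSum_inner_comp {s : Type*} (e : HilbertBasis s ℂ H) (A : F →L[ℂ] H) (B : H →L[ℂ] F) :
    HasSum (fun i => ⟪e i, A (B (e i))⟫_ℂ)
      (LinearMap.trace ℂ F ((B ∘L A : F →L[ℂ] F) : F →ₗ[ℂ] F)) := by
  simp only [inner_comp_apply A B]
  rw [LinearMap.trace_eq_sum_inner _ (stdOrthonormalBasis ℂ F)]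
  refine hasSum_sum fun j _ => ?_
  have h := e.hasSum_inner_mul_inner
    (ContinuousLinearMap.adjoint B (stdOrthonormalBasis ℂ F j)) (A (stdOrthonormalBasis ℂ F j))
  rw [ContinuousLinearMap.adjoint_inner_left] at h
  simp only [mul_comm] at h ⊢
  exact h

variable {c : ℝ → ℂ} {A : ℝ → F →L[ℂ] K} {B : ℝ → H →L[ℂ] F}

lemma inner_integral_comp_apply (hc : IntervalIntegrable c volume 0 1) (hA : Continuous A)
    (hB : Continuous B) (u : H) (v : K) :
    ⟪v, (∫ t in (0 : ℝ)..1, c t • (A t ∘L B t)) u⟫_ℂ =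
      ∫ t in (0 : ℝ)..1, c t * ⟪v, A t (B t u)⟫_ℂ := by
  have hi : IntervalIntegrable (fun t => c t • (A t ∘L B t)) volume 0 1 :=
    hc.smul_continuousOn (hA.clm_comp hB).continuousOn
  have h := (innerSL ℂ v ∘L ContinuousLinearMap.apply ℂ K u).intervalIntegral_comp_comm hi
  simpa using h.symm

lemma intervalIntegrable_mul_inner (hc : IntervalIntegrable c volume 0 1) (hA : Continuous A)
    (hB : Continuous B) (u : H) (v : K) :
    IntervalIntegrable (fun t => c t * ⟪v, A t (B t u)⟫_ℂ) volume 0 1 :=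
  hc.mul_continuousOn
    (continuous_const.inner (hA.clm_apply (hB.clm_apply continuous_const))).continuousOn

/-- The bound is independent of `Φ`; it serves both the trace class property and the exchange of sum
and integral. -/
lemma sum_integral_norm_le (hc : IntervalIntegrable c volume 0 1) (hA : Continuous A)
    (hB : Continuous B) {ι : Type*} {u : ι → H} {v : ι → K} (hu : Orthonormal ℂ u)
    (hv : Orthonormal ℂ v) (Φ : Finset ι) :
    ∑ i ∈ Φ, ∫ t in (0 : ℝ)..1, ‖c t * ⟪v i, A t (B t (u i))⟫_ℂ‖ ≤
      ∫ t in (0 : ℝ)..1, ‖c t‖ * traceBound (A t) (B t) := by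
  rw [← intervalIntegral.integral_finsetSum fun i _ =>
    (intervalIntegrable_mul_inner hc hA hB (u i) (v i)).norm]
  refine intervalIntegral.integral_mono_on zero_le_one
    (by
      simpa only [Finset.sum_fn] using IntervalIntegrable.sum Φ fun i _ =>
        (intervalIntegrable_mul_inner hc hA hB (u i) (v i)).norm)
    (hc.norm.mul_continuousOn (continuous_traceBound hA hB).continuousOn) fun t _ => ?_
  simp only [norm_mul]
  rw [← Finset.mul_sum]
  exact mul_le_mul_of_nonneg_left (sum_norm_inner_comp_le _ _ hu hv Φ) (norm_nonneg _)

/-- An integral of operators which factor continuously through a fixed finite dimensional space is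
of trace class. -/
theorem isTraceClass_integral_comp (hc : IntervalIntegrable c volume 0 1) (hA : Continuous A)
    (hB : Continuous B) : IsTraceClass (∫ t in (0 : ℝ)..1, c t • (A t ∘L B t)) := by
  refine isTraceClass_of_sum_le
    (C := ∫ t in (0 : ℝ)..1, ‖c t‖ * traceBound (A t) (B t)) ?_ fun s u v hu hv Φ => ?_
  -- Compact operators form a closed subspace, and each value of the integrand has finite rank.
  · refine intervalIntegral_mem_of_isClosed (S := compactOperator (RingHom.id ℂ) H K)
      isClosed_setOfPred_isCompactOperator
      (hc.smul_continuousOn (hA.clm_comp hB).continuousOn) fun t => ?_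
    have : ProperSpace F := FiniteDimensional.proper ℂ F
    exact Submodule.smul_mem _ _
      ((isCompactOperator_of_locallyCompactSpace_rng (A t)).comp_clm (B t))
  · refine le_trans (Finset.sum_le_sum fun i _ => ?_) (sum_integral_norm_le hc hA hB hu hv Φ)
    rw [inner_integral_comp_apply hc hA hB]
    exact intervalIntegral.norm_integral_le_integral_norm zero_le_one

/-- The trace of an integral of operators which factor continuously through a fixed finite
dimensional space is the integral of the traces. -/
theorem hasTrace_integral_comp {A : ℝ → F →L[ℂ] H} (hc : IntervalIntegrable c volume 0 1)
    (hA : Continuous A) (hB : Continuous B) :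
    HasTrace (∫ t in (0 : ℝ)..1, c t • (A t ∘L B t))
      (∫ t in (0 : ℝ)..1,
        c t * LinearMap.trace ℂ F ((B t ∘L A t : F →L[ℂ] F) : F →ₗ[ℂ] F)) := by
  intro s e
  set k : s → ℝ → ℂ := fun i t => ⟪e i, A t (B t (e i))⟫_ℂ with hk
  have hkc : ∀ i, Continuous (k i) := fun i =>
    continuous_const.inner (hA.clm_apply (hB.clm_apply continuous_const))
  have hsum : ∀ t, HasSum (fun i => k i t)
      (LinearMap.trace ℂ F ((B t ∘L A t : F →L[ℂ] F) : F →ₗ[ℂ] F)) := fun t =>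
    hasSum_inner_comp e (A t) (B t)
  simp only [inner_integral_comp_apply hc hA hB]
  -- The basis may be uncountable, but the exchange of sum and integral needs a countable index. For
  -- each rational `t` only countably many terms are nonzero, and continuity in `t` rules out any
  -- others.
  set J : Set s := {i | ∃ t, k i t ≠ 0} with hJ
  have hJc : J.Countable := by
    refine (countable_iUnion fun q : ℚ => (hsum q).summable.countable_support).mono ?_
    rintro i ⟨t, ht⟩
    obtain ⟨q, hq⟩ := (Rat.denseRange_cast (𝕜 := ℝ)).exists_mem_open
      ((hkc i).isOpen_preimage _ (isOpen_compl_singleton (x := 0))) ⟨t, ht⟩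
    exact mem_iUnion.2 ⟨q, hq⟩
  have hz : ∀ i ∉ J, ∀ t, k i t = 0 := fun i hi t => by
    by_contra hne
    exact hi ⟨t, hne⟩
  rw [← hasSum_subtype_iff_of_support_subset (s := J)]
  · have : Countable J := hJc.to_subtype
    have hsumJ : ∀ t, ∑' i : J, c t * k i t =
        c t * LinearMap.trace ℂ F ((B t ∘L A t : F →L[ℂ] F) : F →ₗ[ℂ] F) := fun t =>
      (((hasSum_subtype_iff_of_support_subset fun i hi => by
        by_contra hne
        exact hi (hz i hne t)).2 (hsum t)).mul_left (c t)).tsum_eq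
    have h := hasSum_integral_of_summable_integral_norm
      (μ := volume.restrict (Ioc (0 : ℝ) 1)) (F := fun (i : J) t => c t * k i t)
      (fun i => ((intervalIntegrable_iff_integrableOn_Ioc_of_le zero_le_one).1
        (intervalIntegrable_mul_inner hc hA hB (e i) (e i))))
      (summable_of_sum_le
        (c := ∫ t in (0 : ℝ)..1, ‖c t‖ * traceBound (A t) (B t))
        (fun i => integral_nonneg fun t => norm_nonneg _) fun Φ => by
          have hJ' : Orthonormal ℂ fun i : J => e i :=
            e.orthonormal.comp _ Subtype.val_injective
          have := sum_integral_norm_le hc hA hB hJ' hJ' Φ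
          simpa only [intervalIntegral.integral_of_le zero_le_one] using this)
    simp only [hsumJ] at h
    simp only [intervalIntegral.integral_of_le zero_le_one]
    exact h
  · intro i hi
    by_contra hne
    refine hi ?_
    have h0 : ∀ t, ⟪e i, A t (B t (e i))⟫_ℂ = 0 := hz i hne
    simp [h0]

end Integrals

/-! ### The trace as a continuous functional -/

section Trace

variable {F : Type*} [NormedAddCommGroup F] [InnerProductSpace ℂ F] [FiniteDimensional ℂ F]

variable (F) in
/-- The trace as a continuous linear functional on operators in a finite dimensional space. -/
def traceCLM : (F →L[ℂ] F) →L[ℂ] ℂ :=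
  ∑ j, innerSL ℂ (stdOrthonormalBasis ℂ F j) ∘L
    ContinuousLinearMap.apply ℂ F (stdOrthonormalBasis ℂ F j)

lemma traceCLM_apply (A : F →L[ℂ] F) : traceCLM F A = LinearMap.trace ℂ F (A : F →ₗ[ℂ] F) := by
  rw [LinearMap.trace_eq_sum_inner _ (stdOrthonormalBasis ℂ F)]
  simp [traceCLM]

lemma traceCLM_comp_comm {G : Type*} [NormedAddCommGroup G] [InnerProductSpace ℂ G]
    [FiniteDimensional ℂ G] (A : F →L[ℂ] G) (B : G →L[ℂ] F) :
    traceCLM G (A ∘L B) = traceCLM F (B ∘L A) := by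
  rw [traceCLM_apply, traceCLM_apply]
  exact LinearMap.trace_comp_comm' (B : G →ₗ[ℂ] F) (A : F →ₗ[ℂ] G)

end Trace

/-! ### Algebra of the Grushin problem -/

section Blocks

variable {H₁ H₂ Hp Hm : Type*}
  [NormedAddCommGroup H₁] [NormedSpace ℂ H₁] [NormedAddCommGroup H₂] [NormedSpace ℂ H₂]
  [NormedAddCommGroup Hp] [NormedSpace ℂ Hp] [NormedAddCommGroup Hm] [NormedSpace ℂ Hm]

/-- The upper left entry `E : H₂ → H₁` of the inverse of a Grushin problem. -/
def resolventEntry (P : H₁ →L[ℂ] H₂) (Rm : Hm →L[ℂ] H₂) (Rp : H₁ →L[ℂ] Hp) : H₂ →L[ℂ] H₁ :=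
  ContinuousLinearMap.fst ℂ H₁ Hm ∘L (system P Rm Rp).inverse ∘L ContinuousLinearMap.inl ℂ H₂ Hp

/-- The upper right entry `E₊ : H₊ → H₁` of the inverse of a Grushin problem. -/
def plusEntry (P : H₁ →L[ℂ] H₂) (Rm : Hm →L[ℂ] H₂) (Rp : H₁ →L[ℂ] Hp) : Hp →L[ℂ] H₁ :=
  ContinuousLinearMap.fst ℂ H₁ Hm ∘L (system P Rm Rp).inverse ∘L ContinuousLinearMap.inr ℂ H₂ Hp

/-- The lower left entry `E₋ : H₂ → H₋` of the inverse of a Grushin problem. -/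
def minusEntry (P : H₁ →L[ℂ] H₂) (Rm : Hm →L[ℂ] H₂) (Rp : H₁ →L[ℂ] Hp) : H₂ →L[ℂ] Hm :=
  ContinuousLinearMap.snd ℂ H₁ Hm ∘L (system P Rm Rp).inverse ∘L ContinuousLinearMap.inl ℂ H₂ Hp

namespace IsWellPosed

variable {P : H₁ →L[ℂ] H₂} {Rm : Hm →L[ℂ] H₂} {Rp : H₁ →L[ℂ] Hp} (h : IsWellPosed P Rm Rp)

include h

lemma system_inverse_apply (y : H₂ × Hp) : system P Rm Rp ((system P Rm Rp).inverse y) = y :=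
  ContinuousLinearMap.ext_iff.1 (ContinuousLinearMap.IsInvertible.self_comp_inverse h) y

lemma inverse_system_apply (x : H₁ × Hm) : (system P Rm Rp).inverse (system P Rm Rp x) = x :=
  ContinuousLinearMap.ext_iff.1 (ContinuousLinearMap.IsInvertible.inverse_comp_self h) x

lemma resolvent_add (v : H₂) :
    P (resolventEntry P Rm Rp v) + Rm (minusEntry P Rm Rp v) = v :=
  congrArg Prod.fst (h.system_inverse_apply (v, 0))

lemma plus_add (v : Hp) :
    P (plusEntry P Rm Rp v) + Rm (effectiveHamiltonian P Rm Rp v) = 0 :=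
  congrArg Prod.fst (h.system_inverse_apply (0, v))

lemma Rp_plus (v : Hp) : Rp (plusEntry P Rm Rp v) = v :=
  congrArg Prod.snd (h.system_inverse_apply (0, v))

lemma minus_Rm (u : Hm) : minusEntry P Rm Rp (Rm u) = u := by
  have := congrArg Prod.snd (h.inverse_system_apply (0, u))
  simpa [system, minusEntry] using this

lemma minus_add (u : H₁) :
    minusEntry P Rm Rp (P u) + effectiveHamiltonian P Rm Rp (Rp u) = 0 := by
  have h1 := congrArg Prod.snd (h.inverse_system_apply (u, 0))
  have h2 : system P Rm Rp (u, 0) =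
      ContinuousLinearMap.inl ℂ H₂ Hp (P u) + ContinuousLinearMap.inr ℂ H₂ Hp (Rp u) := by
    simp [system]
  rw [h2, map_add] at h1
  exact h1

lemma finiteDimensional_plus (hR : HasFiniteRank Rp) : FiniteDimensional ℂ Hp := by
  have hR' : FiniteDimensional ℂ (LinearMap.range (Rp : H₁ →ₗ[ℂ] Hp)) := hR
  have htop : LinearMap.range (Rp : H₁ →ₗ[ℂ] Hp) = ⊤ :=
    LinearMap.range_eq_top.2 fun v => ⟨_, h.Rp_plus v⟩
  rw [htop] at hR'
  exact Submodule.topEquiv.finiteDimensional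

lemma finiteDimensional_minus (hR : HasFiniteRank Rm) : FiniteDimensional ℂ Hm := by
  have hR' : FiniteDimensional ℂ (LinearMap.range (Rm : Hm →ₗ[ℂ] H₂)) := hR
  have hinj : Function.Injective (Rm : Hm →ₗ[ℂ] H₂) :=
    Function.LeftInverse.injective h.minus_Rm
  exact (LinearEquiv.ofInjective (Rm : Hm →ₗ[ℂ] H₂) hinj).symm.finiteDimensional

/-- If `P` is invertible then so is the effective Hamiltonian. -/
lemma isInvertible_effectiveHamiltonian (hP : P.IsInvertible) :
    (effectiveHamiltonian P Rm Rp).IsInvertible := by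
  have hPl : ∀ v, P.inverse (P v) = v := fun v =>
    ContinuousLinearMap.ext_iff.1 hP.inverse_comp_self v
  have hPr : ∀ v, P (P.inverse v) = v := fun v =>
    ContinuousLinearMap.ext_iff.1 hP.self_comp_inverse v
  -- The inverse `-R₊ P⁻¹ R₋` comes from `R₋ E₋₊ = -P E₊` and `R₊ E₊ = 1`.
  refine ⟨ContinuousLinearEquiv.equivOfInverse (effectiveHamiltonian P Rm Rp)
    (-(Rp ∘L P.inverse ∘L Rm)) (fun v => ?_) fun u => ?_, rfl⟩
  · have h1 : Rm (effectiveHamiltonian P Rm Rp v) = -P (plusEntry P Rm Rp v) :=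
      eq_neg_of_add_eq_zero_right (h.plus_add v)
    simp [h1, hPl, h.Rp_plus]
  · have h1 := eq_neg_of_add_eq_zero_right (h.minus_add (P.inverse (Rm u)))
    rw [hPr, h.minus_Rm] at h1
    simp [h1]

/-- The Schur complement formula `P⁻¹ = E - E₊ E₋₊⁻¹ E₋`. -/
lemma inverse_eq (hP : P.IsInvertible) :
    P.inverse = resolventEntry P Rm Rp -
      (plusEntry P Rm Rp ∘L (effectiveHamiltonian P Rm Rp).inverse) ∘L minusEntry P Rm Rp := by
  ext v
  have hPl : ∀ v, P.inverse (P v) = v := fun v =>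
    ContinuousLinearMap.ext_iff.1 hP.inverse_comp_self v
  have hE : ∀ v, effectiveHamiltonian P Rm Rp ((effectiveHamiltonian P Rm Rp).inverse v) = v :=
    fun v => ContinuousLinearMap.ext_iff.1
      (h.isInvertible_effectiveHamiltonian hP).self_comp_inverse v
  set w := (effectiveHamiltonian P Rm Rp).inverse (minusEntry P Rm Rp v) with hw
  have h1 := h.plus_add w
  rw [hw, hE, ← hw] at h1
  have h2 : P (resolventEntry P Rm Rp v - plusEntry P Rm Rp w) = v := by
    rw [map_sub, eq_neg_of_add_eq_zero_left h1, sub_neg_eq_add, h.resolvent_add]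
  have h3 := hPl (resolventEntry P Rm Rp v - plusEntry P Rm Rp w)
  rw [h2] at h3
  exact h3

end IsWellPosed

end Blocks

/-! ### Holomorphy of the entries of the inverse -/

section Holomorphy

variable {H₁ H₂ Hp Hm : Type*}
  [NormedAddCommGroup H₁] [NormedSpace ℂ H₁] [NormedAddCommGroup H₂] [NormedSpace ℂ H₂]
  [NormedAddCommGroup Hp] [NormedSpace ℂ Hp] [NormedAddCommGroup Hm] [NormedSpace ℂ Hm]

lemma system_eq (P : H₁ →L[ℂ] H₂) (Rm : Hm →L[ℂ] H₂) (Rp : H₁ →L[ℂ] Hp) :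
    system P Rm Rp =
      ContinuousLinearMap.inl ℂ H₂ Hp ∘L P ∘L ContinuousLinearMap.fst ℂ H₁ Hm +
      ContinuousLinearMap.inl ℂ H₂ Hp ∘L Rm ∘L ContinuousLinearMap.snd ℂ H₁ Hm +
      ContinuousLinearMap.inr ℂ H₂ Hp ∘L Rp ∘L ContinuousLinearMap.fst ℂ H₁ Hm := by
  ext x <;> simp [system]

/-- The pointwise inverse of a holomorphic family of invertible operators is holomorphic. -/
lemma differentiableOn_inverse [CompleteSpace H₁] {A : ℂ → H₁ →L[ℂ] H₂} {Ω : Set ℂ}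
    (hA : DifferentiableOn ℂ A Ω) (hinv : ∀ z ∈ Ω, (A z).IsInvertible) :
    DifferentiableOn ℂ (fun z => (A z).inverse) Ω := fun z hz =>
  (((hinv z hz).contDiffAt_map_inverse (n := 1)).differentiableAt
    one_ne_zero).comp_differentiableWithinAt z (hA z hz)

variable [CompleteSpace H₁] [CompleteSpace Hm] {Ω : Set ℂ}
  {P : ℂ → H₁ →L[ℂ] H₂} {Rm : ℂ → Hm →L[ℂ] H₂} {Rp : ℂ → H₁ →L[ℂ] Hp}

lemma differentiableOn_system_inverse (hP : DifferentiableOn ℂ P Ω)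
    (hRm : DifferentiableOn ℂ Rm Ω) (hRp : DifferentiableOn ℂ Rp Ω)
    (hwp : ∀ z ∈ Ω, IsWellPosed (P z) (Rm z) (Rp z)) :
    DifferentiableOn ℂ (fun z => (system (P z) (Rm z) (Rp z)).inverse) Ω := by
  refine differentiableOn_inverse ?_ hwp
  simp only [system_eq]
  exact (((differentiableOn_const _).clm_comp (hP.clm_comp (differentiableOn_const _))).add
    ((differentiableOn_const _).clm_comp (hRm.clm_comp (differentiableOn_const _)))).add
    ((differentiableOn_const _).clm_comp (hRp.clm_comp (differentiableOn_const _)))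

lemma differentiableOn_effectiveHamiltonian (hP : DifferentiableOn ℂ P Ω)
    (hRm : DifferentiableOn ℂ Rm Ω) (hRp : DifferentiableOn ℂ Rp Ω)
    (hwp : ∀ z ∈ Ω, IsWellPosed (P z) (Rm z) (Rp z)) :
    DifferentiableOn ℂ (fun z => effectiveHamiltonian (P z) (Rm z) (Rp z)) Ω :=
  (differentiableOn_const _).clm_comp
    ((differentiableOn_system_inverse hP hRm hRp hwp).clm_comp (differentiableOn_const _))

lemma differentiableOn_resolventEntry (hP : DifferentiableOn ℂ P Ω)
    (hRm : DifferentiableOn ℂ Rm Ω) (hRp : DifferentiableOn ℂ Rp Ω)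
    (hwp : ∀ z ∈ Ω, IsWellPosed (P z) (Rm z) (Rp z)) :
    DifferentiableOn ℂ (fun z => resolventEntry (P z) (Rm z) (Rp z)) Ω :=
  (differentiableOn_const _).clm_comp
    ((differentiableOn_system_inverse hP hRm hRp hwp).clm_comp (differentiableOn_const _))

lemma differentiableOn_plusEntry (hP : DifferentiableOn ℂ P Ω)
    (hRm : DifferentiableOn ℂ Rm Ω) (hRp : DifferentiableOn ℂ Rp Ω)
    (hwp : ∀ z ∈ Ω, IsWellPosed (P z) (Rm z) (Rp z)) :
    DifferentiableOn ℂ (fun z => plusEntry (P z) (Rm z) (Rp z)) Ω :=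
  (differentiableOn_const _).clm_comp
    ((differentiableOn_system_inverse hP hRm hRp hwp).clm_comp (differentiableOn_const _))

lemma differentiableOn_minusEntry (hP : DifferentiableOn ℂ P Ω)
    (hRm : DifferentiableOn ℂ Rm Ω) (hRp : DifferentiableOn ℂ Rp Ω)
    (hwp : ∀ z ∈ Ω, IsWellPosed (P z) (Rm z) (Rp z)) :
    DifferentiableOn ℂ (fun z => minusEntry (P z) (Rm z) (Rp z)) Ω :=
  (differentiableOn_const _).clm_comp
    ((differentiableOn_system_inverse hP hRm hRp hwp).clm_comp (differentiableOn_const _))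

/-- The derivative of the effective Hamiltonian,
`Ė₋₊ = -(E₋ Ṗ E₊ + E₋₊ Ṙ₊ E₊ + E₋ Ṙ₋ E₋₊)`. -/
lemma deriv_effectiveHamiltonian (hΩ : IsOpen Ω) (hP : DifferentiableOn ℂ P Ω)
    (hRm : DifferentiableOn ℂ Rm Ω) (hRp : DifferentiableOn ℂ Rp Ω)
    (hwp : ∀ z ∈ Ω, IsWellPosed (P z) (Rm z) (Rp z)) {z : ℂ} (hz : z ∈ Ω) :
    deriv (fun z => effectiveHamiltonian (P z) (Rm z) (Rp z)) z =
      -(minusEntry (P z) (Rm z) (Rp z) ∘L (deriv P z ∘L plusEntry (P z) (Rm z) (Rp z)) +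
        effectiveHamiltonian (P z) (Rm z) (Rp z) ∘L
          (deriv Rp z ∘L plusEntry (P z) (Rm z) (Rp z)) +
        (minusEntry (P z) (Rm z) (Rp z) ∘L deriv Rm z) ∘L
          effectiveHamiltonian (P z) (Rm z) (Rp z)) := by
  have hnhds := hΩ.mem_nhds hz
  have dP := (hP.differentiableAt hnhds).hasDerivAt
  have dRm := (hRm.differentiableAt hnhds).hasDerivAt
  have dRp := (hRp.differentiableAt hnhds).hasDerivAt
  have dEmp := ((differentiableOn_effectiveHamiltonian hP hRm hRp hwp).differentiableAt
    hnhds).hasDerivAt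
  have dEm := ((differentiableOn_minusEntry hP hRm hRp hwp).differentiableAt hnhds).hasDerivAt
  set DE := deriv (fun z => effectiveHamiltonian (P z) (Rm z) (Rp z)) z
  set DM := deriv (fun z => minusEntry (P z) (Rm z) (Rp z)) z
  have h1 : HasDerivAt (fun z => minusEntry (P z) (Rm z) (Rp z) ∘L P z +
      effectiveHamiltonian (P z) (Rm z) (Rp z) ∘L Rp z) 0 z := by
    refine (hasDerivAt_const z (0 : H₁ →L[ℂ] Hm)).congr_of_eventuallyEq ?_
    filter_upwards [hnhds] with w hw
    ext u
    exact (hwp w hw).minus_add u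
  have h2 : HasDerivAt (fun z => minusEntry (P z) (Rm z) (Rp z) ∘L Rm z) 0 z := by
    refine (hasDerivAt_const z (ContinuousLinearMap.id ℂ Hm)).congr_of_eventuallyEq ?_
    filter_upwards [hnhds] with w hw
    ext u
    exact (hwp w hw).minus_Rm u
  have e1 := ((dEm.clm_comp dP).add (dEmp.clm_comp dRp)).unique h1
  have e2 := (dEm.clm_comp dRm).unique h2
  -- Evaluate the first differentiated identity on `E₊ v` and the second on `E₋₊ v`. Since `P E₊ =
  -- -R₋ E₋₊`, the terms with `Ė₋` cancel in the sum.
  ext v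
  have f1 := ContinuousLinearMap.ext_iff.1 e1 (plusEntry (P z) (Rm z) (Rp z) v)
  have f2 := ContinuousLinearMap.ext_iff.1 e2 (effectiveHamiltonian (P z) (Rm z) (Rp z) v)
  have f3 := eq_neg_of_add_eq_zero_left ((hwp z hz).plus_add v)
  simp only [add_apply, ContinuousLinearMap.comp_apply, zero_apply, (hwp z hz).Rp_plus, f3,
    map_neg] at f1 f2
  simp only [neg_apply, add_apply, ContinuousLinearMap.comp_apply]
  rw [eq_neg_iff_add_eq_zero]
  have f4 := congrArg₂ (· + ·) f1 f2
  simp only [add_zero] at f4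
  rw [← f4]
  abel

end Holomorphy

/-! ### The logarithmic derivative under the trace -/

section LogarithmicResidue

variable {H₁ H₂ Hp Hm : Type*}
  [NormedAddCommGroup H₁] [InnerProductSpace ℂ H₁]
  [NormedAddCommGroup H₂] [InnerProductSpace ℂ H₂]
  [NormedAddCommGroup Hp] [InnerProductSpace ℂ Hp] [FiniteDimensional ℂ Hp]
  [NormedAddCommGroup Hm] [InnerProductSpace ℂ Hm] [FiniteDimensional ℂ Hm]

/-- Needed on `γ` itself, where invertibility is known only on a set that is not open. -/
lemma continuousOn_inverse [CompleteSpace H₁] {A : ℂ → H₁ →L[ℂ] H₂} {s : Set ℂ}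
    (hA : ContinuousOn A s) (hinv : ∀ z ∈ s, (A z).IsInvertible) :
    ContinuousOn (fun z => (A z).inverse) s := fun z hz =>
  ((hinv z hz).contDiffAt_map_inverse (n := 1)).continuousAt.comp_continuousWithinAt (hA z hz)

/-- The trace of `-E₋ Ṗ E₊ E₋₊⁻¹` in terms of the logarithmic derivative of the effective
Hamiltonian. -/
lemma traceCLM_minus_comp_plus (Em : H₂ →L[ℂ] Hm) (Ep : Hp →L[ℂ] H₁) (W DW : Hp →L[ℂ] Hm)
    (DP : H₁ →L[ℂ] H₂) (DRm : Hm →L[ℂ] H₂) (DRp : H₁ →L[ℂ] Hp) (hW : W.IsInvertible)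
    (hDW : DW = -(Em ∘L (DP ∘L Ep) + W ∘L (DRp ∘L Ep) + (Em ∘L DRm) ∘L W)) :
    traceCLM Hm (Em ∘L (-(DP ∘L (Ep ∘L W.inverse)))) =
      traceCLM Hm (DW ∘L W.inverse) + (traceCLM Hp (DRp ∘L Ep) + traceCLM Hm (Em ∘L DRm)) := by
  have hl : W.inverse ∘L W = ContinuousLinearMap.id ℂ Hp := hW.inverse_comp_self
  have hr : W ∘L W.inverse = ContinuousLinearMap.id ℂ Hm := hW.self_comp_inverse
  -- Conjugation by `W` moves this trace from `H₊` to `H₋`.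
  have h1 : traceCLM Hp (DRp ∘L Ep) = traceCLM Hm ((W ∘L (DRp ∘L Ep)) ∘L W.inverse) := by
    rw [traceCLM_comp_comm (W ∘L (DRp ∘L Ep)) W.inverse, ← ContinuousLinearMap.comp_assoc, hl,
      ContinuousLinearMap.id_comp]
  have h2 : Em ∘L DRm = ((Em ∘L DRm) ∘L W) ∘L W.inverse := by
    rw [ContinuousLinearMap.comp_assoc, hr, ContinuousLinearMap.comp_id]
  rw [h1, h2, ← map_add, ← map_add, hDW]
  congr 1
  ext v
  simp only [neg_apply, add_apply, ContinuousLinearMap.comp_apply, map_neg]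
  abel

end LogarithmicResidue

end Grushin

end

/-! ### The trace formula -/

theorem proposition4p1
    {H₁ H₂ Hp Hm : Type*}
    [NormedAddCommGroup H₁] [InnerProductSpace ℂ H₁] [CompleteSpace H₁]
    [NormedAddCommGroup H₂] [InnerProductSpace ℂ H₂] [CompleteSpace H₂]
    [NormedAddCommGroup Hp] [InnerProductSpace ℂ Hp] [CompleteSpace Hp]
    [NormedAddCommGroup Hm] [InnerProductSpace ℂ Hm] [CompleteSpace Hm]
    (Ω : Set ℂ) (hΩ : IsOpen Ω) (hΩc : IsConnected Ω)
    (P : ℂ → H₁ →L[ℂ] H₂) (hP : DifferentiableOn ℂ P Ω)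
    (hPF : ∀ z ∈ Ω, Grushin.IsFredholm (P z))
    (Rm : ℂ → Hm →L[ℂ] H₂) (hRm : DifferentiableOn ℂ Rm Ω)
    (hRmF : ∀ z ∈ Ω, Grushin.HasFiniteRank (Rm z))
    (Rp : ℂ → H₁ →L[ℂ] Hp) (hRp : DifferentiableOn ℂ Rp Ω)
    (hRpF : ∀ z ∈ Ω, Grushin.HasFiniteRank (Rp z))
    (hwp : ∀ z ∈ Ω, Grushin.IsWellPosed (P z) (Rm z) (Rp z))
    (Emp : ℂ → Hp →L[ℂ] Hm)
    (hEmp : ∀ z, Emp z = Grushin.effectiveHamiltonian (P z) (Rm z) (Rp z))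
    (z₀ : ℂ) (hz₀ : z₀ ∈ Ω) (hE₀ : (Emp z₀).IsInvertible)
    (g : ℂ → ℂ) (hg : DifferentiableOn ℂ g Ω)
    (a : ℂ) (γ : Path a a) (hγ : Grushin.IsPiecewiseC1 γ)
    (hγ₀ : Grushin.IsNullHomologous γ Ω)
    (hγP : ∀ z ∈ Set.range γ, (P z).IsInvertible) :
    -- the integrands are meaningful
    DifferentiableOn ℂ Emp Ω ∧
    (∀ z ∈ Set.range γ, (Emp z).IsInvertible) ∧
    CurveIntegrable (Grushin.dzForm fun z => g z • (deriv P z ∘L (P z).inverse)) γ ∧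
    CurveIntegrable (Grushin.dzForm fun z => g z • (deriv Emp z ∘L (Emp z).inverse)) γ ∧
    -- the integrals are of trace class and have the same trace
    Grushin.IsTraceClass
      (∫ᶜ z in γ, Grushin.dzForm (fun z => g z • (deriv P z ∘L (P z).inverse)) z) ∧
    Grushin.IsTraceClass
      (∫ᶜ z in γ, Grushin.dzForm (fun z => g z • (deriv Emp z ∘L (Emp z).inverse)) z) ∧
    ∃ τ : ℂ,
      Grushin.HasTrace
        (∫ᶜ z in γ, Grushin.dzForm (fun z => g z • (deriv P z ∘L (P z).inverse)) z) τ ∧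
      Grushin.HasTrace
        (∫ᶜ z in γ, Grushin.dzForm (fun z => g z • (deriv Emp z ∘L (Emp z).inverse)) z) τ := by
  open Grushin in
  obtain rfl : Emp = fun z => effectiveHamiltonian (P z) (Rm z) (Rp z) := funext hEmp
  have := (hwp z₀ hz₀).finiteDimensional_plus (hRpF z₀ hz₀)
  have := (hwp z₀ hz₀).finiteDimensional_minus (hRmF z₀ hz₀)
  set W : ℂ → Hp →L[ℂ] Hm := fun z => effectiveHamiltonian (P z) (Rm z) (Rp z) with hW
  set E : ℂ → H₂ →L[ℂ] H₁ := fun z => resolventEntry (P z) (Rm z) (Rp z) with hE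
  set Ep : ℂ → Hp →L[ℂ] H₁ := fun z => plusEntry (P z) (Rm z) (Rp z) with hEp
  set Em : ℂ → H₂ →L[ℂ] Hm := fun z => minusEntry (P z) (Rm z) (Rp z) with hEm
  have dW : DifferentiableOn ℂ W Ω := differentiableOn_effectiveHamiltonian hP hRm hRp hwp
  have dE : DifferentiableOn ℂ E Ω := differentiableOn_resolventEntry hP hRm hRp hwp
  have dEp : DifferentiableOn ℂ Ep Ω := differentiableOn_plusEntry hP hRm hRp hwp
  have dEm : DifferentiableOn ℂ Em Ω := differentiableOn_minusEntry hP hRm hRp hwp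
  have dP' := hP.deriv hΩ
  have hWinv : ∀ z ∈ Set.range γ, (W z).IsInvertible := fun z hz =>
    (hwp z (hγ₀.1 hz)).isInvertible_effectiveHamiltonian (hγP z hz)
  have hsub := hγ₀.1
  have cg := hg.continuousOn.mono hsub
  have cWi := continuousOn_inverse (dW.continuousOn.mono hsub) hWinv
  have cPi := continuousOn_inverse (hP.continuousOn.mono hsub) hγP
  have cPint : ContinuousOn (fun z => g z • (deriv P z ∘L (P z).inverse)) (Set.range γ) :=
    cg.smul ((dP'.continuousOn.mono hsub).clm_comp cPi)
  have cWlog : ContinuousOn (fun z => deriv W z ∘L (W z).inverse) (Set.range γ) :=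
    ((dW.deriv hΩ).continuousOn.mono hsub).clm_comp cWi
  have cWint : ContinuousOn (fun z => g z • (deriv W z ∘L (W z).inverse)) (Set.range γ) :=
    cg.smul cWlog
  -- the finite rank part of the integrand
  set A : ℂ → Hm →L[ℂ] H₂ := fun z => g z • -(deriv P z ∘L (Ep z ∘L (W z).inverse)) with hA
  have cA : ContinuousOn A (Set.range γ) :=
    cg.smul ((dP'.continuousOn.mono hsub).clm_comp
      ((dEp.continuousOn.mono hsub).clm_comp cWi)).neg
  have cEm := dEm.continuousOn.mono hsub
  have hc := hγ.intervalIntegrable_velocity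
  have dhol : DifferentiableOn ℂ (fun z => g z • (deriv P z ∘L E z)) Ω :=
    hg.smul (dP'.clm_comp dE)
  have dtr : DifferentiableOn ℂ (fun z => g z • (traceCLM Hp (deriv Rp z ∘L Ep z) +
      traceCLM Hm (Em z ∘L deriv Rm z))) Ω :=
    hg.smul (((traceCLM Hp).differentiable.comp_differentiableOn
      ((hRp.deriv hΩ).clm_comp dEp)).add
      ((traceCLM Hm).differentiable.comp_differentiableOn (dEm.clm_comp (hRm.deriv hΩ))))
  have hsplit : ∀ z ∈ Set.range γ, g z • (deriv P z ∘L (P z).inverse) =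
      g z • (deriv P z ∘L E z) + A z ∘L Em z := by
    intro z hz
    rw [(hwp z (hγ₀.1 hz)).inverse_eq (hγP z hz)]
    ext v
    simp [hA, hE, hEp, hEm, hW, sub_eq_add_neg]
  have hPint : ∫ᶜ z in γ, dzForm (fun z => g z • (deriv P z ∘L (P z).inverse)) z =
      ∫ t in (0 : ℝ)..1, velocity γ t • (A (γ.extend t) ∘L Em (γ.extend t)) := by
    rw [curveIntegral_dzForm]
    simp only [hsplit _ (extend_mem_range γ _), smul_add]
    have hi := hγ.intervalIntegrable_velocity_smul
      (continuous_comp_extend γ (dhol.continuousOn.mono hsub))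
    have hi' := hγ.intervalIntegrable_velocity_smul
      (continuous_comp_extend γ (cA.clm_comp cEm))
    rw [intervalIntegral.integral_add hi hi', hγ.integral_eq_zero hΩ hγ₀ dhol, zero_add]
  -- Composing with the identity of `H₋` puts this integral in the same factored form.
  have hWint : ∫ᶜ z in γ, dzForm (fun z => g z • (deriv W z ∘L (W z).inverse)) z =
      ∫ t in (0 : ℝ)..1, velocity γ t • ((g (γ.extend t) • (deriv W (γ.extend t) ∘L
        (W (γ.extend t)).inverse)) ∘L ContinuousLinearMap.id ℂ Hm) := by
    rw [curveIntegral_dzForm]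
    rfl
  have hAc := continuous_comp_extend γ cA
  have hEmc := continuous_comp_extend γ cEm
  have hWc := continuous_comp_extend γ cWint
  have hidc : Continuous fun _ : ℝ => ContinuousLinearMap.id ℂ Hm := continuous_const
  have htrace : ∀ z ∈ Set.range γ, traceCLM Hm (Em z ∘L A z) =
      traceCLM Hm (g z • (deriv W z ∘L (W z).inverse)) +
        g z • (traceCLM Hp (deriv Rp z ∘L Ep z) + traceCLM Hm (Em z ∘L deriv Rm z)) := by
    intro z hz
    rw [hA, ContinuousLinearMap.comp_smul, map_smul, map_smul, ← smul_add,
      traceCLM_minus_comp_plus _ _ _ _ _ _ _ (hWinv z hz)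
        (deriv_effectiveHamiltonian hΩ hP hRm hRp hwp (hsub hz))]
  -- The common trace is computed on `H₋`, after cyclic exchange of the two factors.
  refine ⟨dW, hWinv, ?_, ?_, ?_, ?_,
    ∫ t in (0 : ℝ)..1, velocity γ t * traceCLM Hm (Em (γ.extend t) ∘L A (γ.extend t)), ?_, ?_⟩
  · rw [CurveIntegrable, curveIntegralFun_dzForm]
    exact hγ.intervalIntegrable_velocity_smul (continuous_comp_extend γ cPint)
  · rw [CurveIntegrable, curveIntegralFun_dzForm]
    exact hγ.intervalIntegrable_velocity_smul hWc
  · rw [hPint]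
    exact isTraceClass_integral_comp hc hAc hEmc
  · rw [hWint]
    exact isTraceClass_integral_comp hc hWc hidc
  · rw [hPint]
    simp only [traceCLM_apply]
    exact hasTrace_integral_comp hc hAc hEmc
  · rw [hWint]
    have h := hasTrace_integral_comp hc hWc hidc
    simp only [← traceCLM_apply, ContinuousLinearMap.id_comp] at h
    convert h using 1
    simp only [htrace _ (extend_mem_range γ _), mul_add]
    have hi := hγ.intervalIntegrable_velocity_smul ((traceCLM Hm).continuous.comp hWc)
    have hi' := hγ.intervalIntegrable_velocity_smul
      (continuous_comp_extend γ (dtr.continuousOn.mono hsub))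
    -- The correction term does not involve `E₋₊⁻¹`, so it is holomorphic in all of `Ω` and
    -- integrates to zero.
    have h0 := hγ.integral_eq_zero hΩ hγ₀ dtr
    simp only [smul_eq_mul] at hi hi' h0 ⊢
    exact (intervalIntegral.integral_add hi hi').trans (by rw [h0, add_zero]; rfl)
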